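/- For a rational number $a$ and an integer $n\ge 0$ let $(a)_n=a(a+1)\cdots(a+n-1)$ (with $(a)_0=1$) be the rising factorial. For rational numbers $x,y$ and a positive integer $m$, write $x\equiv y\pmod m$ if the numerator of $x-y$, written in lowest terms, is divisible by $m$. Let $p$ be a prime with $p\equiv 3\pmod 4$. Then $$\sum_{k=0}^{(p^2-1)/2}\frac{(\frac12)_k^3}{k!^3}\equiv p^2\,\frac{(\frac34)_{(p^2-1)/2}}{(\frac54)_{(p^2-1)/2}}\pmod{p^4}$$ and $$\sum_{k=0}^{p^2-1}\frac{(\frac12)_k^3}{k!^3}\equiv p^2\,\frac{(\frac34)_{(p^2-1)/2}}{(\frac54)_{(p^2-1)/2}}\pmod{p^4}.$$ -/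

import Mathlib

/-- Congruence of rational numbers modulo a natural number `m`: written in lowest terms, the
difference `a - b` has a numerator divisible by `m` (so its denominator is coprime to `m`).
For `m = p ^ e` with `p` prime this says `a - b ∈ p ^ e ℤ_(p)`. -/
def RatModEq (m : ℕ) (a b : ℚ) : Prop :=
  (m : ℤ) ∣ (a - b).num

/-- The rising factorial `(a)_n = a (a + 1) ⋯ (a + n - 1)` of a rational number. -/
noncomputable def risingFactorial (a : ℚ) (n : ℕ) : ℚ :=
  (ascPochhammer ℚ n).eval a

/-! At `w = p ^ 2`, Dixon's terminating well-poised sum (`sum_dixonTerm`) equals the right-hand side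
exactly, so its terms must be compared with the cubes modulo `p ^ 4`. The two differ by factors
`dixonFactor`, each 1 modulo `p ^ 2`, and even modulo `p ^ 4` when `p` divides neither `2 j + 1` nor
`2 j + 2`.

Put `p = 2 m + 1` and `k = a p + b`. For `b ≤ m` the accumulated factor modulo `p ^ 4` depends only
on `a`, so a half block contributes an error of (multiple of `p ^ 2`) times its sum of cubes. That
sum is itself divisible by `p ^ 2` (`pDvd_sum_halfRatio_cube`): as a function of the shift `w` it is
affine modulo `p ^ 2`, and it vanishes at `0` by Dixon's sum at `w = p` and at `-p` by reflection.
For `b > m` each cube already carries `p ^ 3`.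

The terms beyond `(p ^ 2 - 1) / 2` vanish modulo `p ^ 4` by the same block estimates, with extra
powers of `p` from the central binomial coefficients. -/

/-! ### Dixon's terminating sum -/

/-- `halfRatio w k` is the product of `(2 j + 1 + w) / (2 j + 2 + w)` over `j < k`, that is,
`((1 + w) / 2)_k / (1 + w / 2)_k` in terms of rising factorials. -/
def halfRatio (w : ℚ) (k : ℕ) : ℚ :=
  ∏ j ∈ Finset.range k, (2 * j + 1 + w) / (2 * j + 2 + w)

@[simp]
theorem halfRatio_zero_right (w : ℚ) : halfRatio w 0 = 1 := by simp [halfRatio]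

theorem halfRatio_succ (w : ℚ) (k : ℕ) :
    halfRatio w (k + 1) = halfRatio w k * ((2 * k + 1 + w) / (2 * k + 2 + w)) := by
  simp only [halfRatio, Finset.prod_range_succ]

theorem halfRatio_add (w : ℚ) (k l : ℕ) :
    halfRatio w (k + l) = halfRatio w k * halfRatio (w + 2 * k) l := by
  rw [halfRatio, Finset.prod_range_add]
  congr 1
  refine Finset.prod_congr rfl fun j _ => ?_
  push_cast
  congr 1 <;> ring

/-- The summand of the well-poised series `₃F₂(1/2, (1 - w)/2, (1 + w)/2; 1 + w/2, 1 - w/2; 1)`. -/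
def dixonTerm (w : ℚ) (k : ℕ) : ℚ :=
  halfRatio 0 k * halfRatio w k * halfRatio (-w) k

theorem dixonTerm_succ (w : ℚ) (k : ℕ) :
    dixonTerm w (k + 1) = dixonTerm w k * ((2 * k + 1) * (2 * k + 1 + w) * (2 * k + 1 - w) /
      ((2 * k + 2) * (2 * k + 2 + w) * (2 * k + 2 - w))) := by
  simp only [dixonTerm, halfRatio_succ, add_zero, ← sub_eq_add_neg]
  simp only [div_eq_mul_inv, mul_inv]
  ring

theorem dixonTerm_add_two (N k : ℕ) (hk : k ≤ N) :
    dixonTerm (2 * N + 3) k =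
      (2 * N + 3) * ((N + k + 1) * (2 * N + 1 - 2 * k)) * dixonTerm (2 * N + 1) k /
        ((2 * N + 1) * ((2 * N + 2 * k + 3) * (N + 1 - k))) := by
  have e8 : (2 * N + 1 : ℚ) ≠ 0 := by positivity
  induction k with
  | zero =>
    have e9 : (N + 1 : ℚ) ≠ 0 := by positivity
    have e3 : (2 * N + 3 : ℚ) ≠ 0 := by positivity
    simp [dixonTerm]
    field_simp
  | succ k ih =>
    have hkN : (k : ℚ) + 1 ≤ N := by exact_mod_cast hk
    have e1 : (2 * k + 2 : ℚ) ≠ 0 := by positivity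
    have e2 : (2 * N + 2 * k + 3 : ℚ) ≠ 0 := by positivity
    have e3 : (2 * N + 2 * k + 5 : ℚ) ≠ 0 := by positivity
    have e4 : (2 * N - 1 - 2 * k : ℚ) ≠ 0 := by intro h; linarith
    have e5 : (2 * N + 1 - 2 * k : ℚ) ≠ 0 := by intro h; linarith
    have e6 : (N + 1 - k : ℚ) ≠ 0 := by intro h; linarith
    have e7 : (N - k : ℚ) ≠ 0 := by intro h; linarith
    rw [dixonTerm_succ, dixonTerm_succ, ih (by omega)]
    have f1 : (2 * k + 2 - (2 * N + 3) : ℚ) = -(2 * N + 1 - 2 * k) := by ring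
    have f2 : (2 * k + 2 - (2 * N + 1) : ℚ) = -(2 * N - 1 - 2 * k) := by ring
    have f3 : (2 * k + 2 + (2 * N + 3) : ℚ) = 2 * N + 2 * k + 5 := by ring
    have f4 : (2 * k + 2 + (2 * N + 1) : ℚ) = 2 * N + 2 * k + 3 := by ring
    have f5 : (2 * N + 2 * ((k + 1 : ℕ) : ℚ) + 3) = 2 * N + 2 * k + 5 := by push_cast; ring
    have f6 : (N + 1 - ((k + 1 : ℕ) : ℚ)) = N - k := by push_cast; ring
    have f7 : (2 * N + 1 - 2 * ((k + 1 : ℕ) : ℚ)) = 2 * N - 1 - 2 * k := by push_cast; ring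
    rw [f1, f2, f3, f4, f5, f6, f7]
    push_cast
    field_simp
    ring

/-- A Zeilberger-type certificate for the first-order recurrence in `N` of Dixon's sum. Stopping at
`n ≤ N` avoids its pole at `n = N + 1`. -/
theorem dixon_telescope (N n : ℕ) (hn : n ≤ N) :
    (2 * N + 1) * (4 * N + 5) * ∑ k ∈ Finset.range n, dixonTerm (2 * N + 3) k -
      (2 * N + 3) * (4 * N + 3) * ∑ k ∈ Finset.range n, dixonTerm (2 * N + 1) k =
    -2 * (2 * N + 3) * n * (2 * N + 1 - 2 * n) / (N + 1 - n) * dixonTerm (2 * N + 1) n := by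
  induction n with
  | zero => simp
  | succ n ih =>
    have ih := ih (by omega)
    have hkN : (n : ℚ) + 1 ≤ N := by exact_mod_cast hn
    have e1 : (2 * n + 2 : ℚ) ≠ 0 := by positivity
    have e2 : (2 * N + 2 * n + 3 : ℚ) ≠ 0 := by positivity
    have e4 : (2 * N - 1 - 2 * n : ℚ) ≠ 0 := by intro h; linarith
    have e6 : (N + 1 - n : ℚ) ≠ 0 := by intro h; linarith
    have e7 : (N - n : ℚ) ≠ 0 := by intro h; linarith
    have e8 : (2 * N + 1 : ℚ) ≠ 0 := by positivity
    have f2 : (2 * n + 2 - (2 * N + 1) : ℚ) = -(2 * N - 1 - 2 * n) := by ring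
    have f4 : (2 * n + 2 + (2 * N + 1) : ℚ) = 2 * N + 2 * n + 3 := by ring
    have f6 : (N + 1 - ((n + 1 : ℕ) : ℚ)) = N - n := by push_cast; ring
    have f7 : (2 * N + 1 - 2 * ((n + 1 : ℕ) : ℚ)) = 2 * N - 1 - 2 * n := by push_cast; ring
    rw [Finset.sum_range_succ, Finset.sum_range_succ, mul_add _ _ (dixonTerm _ n),
      mul_add _ _ (dixonTerm _ n), add_sub_add_comm, ih, dixonTerm_add_two N n (by omega),
      dixonTerm_succ, f2, f4, f6, f7]
    push_cast
    field_simp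
    ring

/-- Dixon's well-poised summation in the terminating case. -/
theorem sum_dixonTerm (N : ℕ) :
    ∑ k ∈ Finset.range (N + 1), dixonTerm (2 * N + 1) k =
      (2 * N + 1) * ∏ j ∈ Finset.range N, ((4 * j + 3) / (4 * j + 5) : ℚ) := by
  induction N with
  | zero => simp [dixonTerm]
  | succ N ih =>
    have ht := dixon_telescope N N le_rfl
    have h2 := dixonTerm_add_two N N le_rfl
    have e0 : (2 * ((N + 1 : ℕ) : ℚ) + 1) = 2 * N + 3 := by push_cast; ring
    have e8 : (2 * N + 1 : ℚ) ≠ 0 := by positivity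
    have e9 : (4 * N + 5 : ℚ) ≠ 0 := by positivity
    have e10 : (4 * N + 3 : ℚ) ≠ 0 := by positivity
    have e1 : (2 * N + 2 : ℚ) ≠ 0 := by positivity
    have e11 : (N + 1 - N : ℚ) = 1 := by ring
    have e15 : (2 * N + 1 - 2 * N : ℚ) = 1 := by ring
    have e16 : (2 * N + 2 * N + 3 : ℚ) = 4 * N + 3 := by ring
    rw [e11, e15, e16] at h2
    rw [Finset.sum_range_succ] at ih
    rw [e0, Finset.prod_range_succ, Finset.sum_range_succ, Finset.sum_range_succ, dixonTerm_succ,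
      h2]
    have e13 : (2 * N + 2 - (2 * N + 3) : ℚ) = -1 := by ring
    have e14 : (2 * N + 2 + (2 * N + 3) : ℚ) = 4 * N + 5 := by ring
    rw [e11, e15] at ht
    rw [e13, e14]
    have ih' : ∑ k ∈ Finset.range N, dixonTerm (2 * N + 1) k =
      (2 * N + 1) * ∏ j ∈ Finset.range N, ((4 * j + 3) / (4 * j + 5) : ℚ) -
        dixonTerm (2 * N + 1) N := by linear_combination ih
    -- The telescoped identity covers `k < N`; the terms `k = N` and `k = N + 1` left over are
    -- multiples of `dixonTerm (2 * N + 1) N` and cancel against the boundary term.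
    rw [ih'] at ht
    have hs : ∑ k ∈ Finset.range N, dixonTerm (2 * N + 3) k =
      ((2 * N + 3) * (4 * N + 3) * ((2 * N + 1) * ∏ j ∈ Finset.range N,
        ((4 * j + 3) / (4 * j + 5) : ℚ) - dixonTerm (2 * N + 1) N) +
        -2 * (2 * N + 3) * N * 1 / 1 *
      dixonTerm (2 * N + 1) N) / ((2 * N + 1) * (4 * N + 5)) := by
      rw [eq_div_iff (by simp [e8, e9])]; linear_combination ht
    rw [hs]
    field_simp
    ring

/-! ### Divisibility by powers of `p` in the rationals -/

/-- The rational number `x` lies in `p ^ e ℤ_(p)`. -/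
def PDvd (p e : ℕ) (x : ℚ) : Prop :=
  padicNorm p x ≤ (p : ℚ) ^ (-(e : ℤ))

namespace PDvd

variable {p : ℕ} {e f : ℕ} {x y u : ℚ}

theorem zero : PDvd p e 0 := by
  simp only [PDvd, padicNorm.zero]
  positivity

theorem neg (hx : PDvd p e x) : PDvd p e (-x) := by
  rwa [PDvd, padicNorm.neg]

theorem of_norm_eq_one (h : padicNorm p x = 1) : PDvd p 0 x := by simp [PDvd, h]

theorem one : PDvd p 0 1 := of_norm_eq_one padicNorm.one

variable [hp : Fact p.Prime]

theorem add (hx : PDvd p e x) (hy : PDvd p e y) : PDvd p e (x + y) :=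
  padicNorm.nonarchimedean.trans (max_le hx hy)

theorem sub (hx : PDvd p e x) (hy : PDvd p e y) : PDvd p e (x - y) :=
  padicNorm.sub.trans (max_le hx hy)

theorem sum {ι : Type*} {s : Finset ι} {g : ι → ℚ} (h : ∀ i ∈ s, PDvd p e (g i)) :
    PDvd p e (∑ i ∈ s, g i) :=
  Finset.sum_induction g (PDvd p e) (fun _ _ => add) zero h

theorem mul (hx : PDvd p e x) (hy : PDvd p f y) : PDvd p (e + f) (x * y) := by
  have hp0 : (p : ℚ) ≠ 0 := by exact_mod_cast hp.out.ne_zero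
  rw [PDvd, padicNorm.mul, Nat.cast_add, neg_add, zpow_add₀ hp0]
  exact mul_le_mul hx hy (padicNorm.nonneg _) (by positivity)

theorem mono (hx : PDvd p e x) (h : f ≤ e) : PDvd p f x :=
  le_trans hx (zpow_le_zpow_right₀ (by exact_mod_cast hp.out.one_le) (by omega))

theorem mul_left (hx : PDvd p 0 x) (hy : PDvd p e y) : PDvd p e (x * y) := by
  simpa using hx.mul hy

theorem mul_right (hx : PDvd p e x) (hy : PDvd p 0 y) : PDvd p e (x * y) := by
  simpa using hx.mul hy

theorem intCast (z : ℤ) : PDvd p 0 z := by simpa [PDvd] using padicNorm.of_int z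

theorem natCast (n : ℕ) : PDvd p 0 n := by simpa using intCast (p := p) n

theorem pow (hx : PDvd p e x) (n : ℕ) : PDvd p (n * e) (x ^ n) := by
  induction n with
  | zero => simpa using one
  | succ n ih =>
    rw [pow_succ, Nat.succ_mul]
    exact ih.mul hx

theorem pow_integral (hx : PDvd p 0 x) (n : ℕ) : PDvd p 0 (x ^ n) := by
  simpa using hx.pow n

theorem prod {ι : Type*} {s : Finset ι} {g : ι → ℚ} (h : ∀ i ∈ s, PDvd p 0 (g i)) :
    PDvd p 0 (∏ i ∈ s, g i) :=
  Finset.prod_induction g (PDvd p 0) (fun _ _ => mul_left) one h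

theorem self : PDvd p 1 p := by
  simp [PDvd, padicNorm.padicNorm_p_of_prime]

theorem of_dvd {z : ℤ} (h : (p : ℤ) ^ e ∣ z) : PDvd p e z := by
  rw [PDvd]
  exact padicNorm.dvd_iff_norm_le.1 (by exact_mod_cast h)

theorem div (hx : PDvd p e x) (hu : padicNorm p u = 1) : PDvd p e (x / u) := by
  rwa [PDvd, padicNorm.div, hu, div_one]

theorem cancel_unit (hu : padicNorm p u = 1) (h : PDvd p e (u * x)) : PDvd p e x := by
  rwa [PDvd, padicNorm.mul, hu, one_mul] at h

theorem cancel_self (h : PDvd p (e + 1) (p * x)) : PDvd p e x := by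
  have hp0 : (0 : ℚ) < p := by exact_mod_cast hp.out.pos
  rw [PDvd, padicNorm.mul, padicNorm.padicNorm_p_of_prime, Nat.cast_add, Nat.cast_one, neg_add,
    zpow_add₀ hp0.ne', zpow_neg_one, mul_comm] at h
  exact le_of_mul_le_mul_right h (inv_pos.2 hp0)

theorem norm_add_eq_one (hu : padicNorm p u = 1) (hx : PDvd p 1 x) : padicNorm p (u + x) = 1 := by
  have h1 : padicNorm p x < 1 := by
    refine lt_of_le_of_lt hx ?_
    simp only [Nat.cast_one, zpow_neg_one]
    exact inv_lt_one_of_one_lt₀ (by exact_mod_cast hp.out.one_lt)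
  rw [padicNorm.add_eq_max_of_ne (by rw [hu]; exact h1.ne'), hu, max_eq_left h1.le]

theorem mul_sub_one (he : PDvd p e (x - 1)) (hf : PDvd p e (y - 1)) : PDvd p e (x * y - 1) := by
  have h : x * y - 1 = (x - 1) * (y - 1) + (x - 1) + (y - 1) := by ring
  rw [h]
  exact (((he.mul hf).mono (by omega)).add he).add hf

theorem prod_sub_one {s : Finset ℕ} {g : ℕ → ℚ} (h : ∀ i ∈ s, PDvd p e (g i - 1)) :
    PDvd p e (∏ i ∈ s, g i - 1) :=
  Finset.prod_induction g (fun x => PDvd p e (x - 1)) (fun _ _ => mul_sub_one)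
    (by simpa using zero) h

theorem ratModEq (h : PDvd p e (x - y)) : RatModEq (p ^ e) x y := by
  rw [RatModEq, padicNorm.dvd_iff_norm_le]
  have h1 : ((x - y).num : ℚ) = (x - y) * (x - y).den := (Rat.mul_den_eq_num _).symm
  rw [h1]
  exact h.mul_right (natCast _)

end PDvd

/-! ### Functions affine modulo `p ^ 2` -/

/-- `f` is integral at `0` and agrees on `p ℤ_(p)` modulo `p ^ 2` with an affine function with
coefficients in `ℤ_(p)`. -/
def AffineModSq (p : ℕ) (f : ℚ → ℚ) : Prop :=
  PDvd p 0 (f 0) ∧ ∃ d, PDvd p 0 d ∧ ∀ w, PDvd p 1 w → PDvd p 2 (f w - f 0 - w * d)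

namespace AffineModSq

variable {p : ℕ} {f g : ℚ → ℚ}

theorem const {c : ℚ} (hc : PDvd p 0 c) : AffineModSq p fun _ => c :=
  ⟨hc, 0, PDvd.zero, fun _ _ => by simpa using PDvd.zero⟩

theorem comp_neg (hf : AffineModSq p f) : AffineModSq p fun w => f (-w) := by
  obtain ⟨hf0, a, ha, hfa⟩ := hf
  refine ⟨by simpa using hf0, -a, ha.neg, fun w hw => ?_⟩
  convert hfa (-w) hw.neg using 1
  simp

variable [hp : Fact p.Prime]

theorem add (hf : AffineModSq p f) (hg : AffineModSq p g) :
    AffineModSq p fun w => f w + g w := by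
  obtain ⟨hf0, a, ha, hfa⟩ := hf
  obtain ⟨hg0, b, hb, hgb⟩ := hg
  refine ⟨hf0.add hg0, a + b, ha.add hb, fun w hw => ?_⟩
  convert (hfa w hw).add (hgb w hw) using 1
  ring

theorem mul (hf : AffineModSq p f) (hg : AffineModSq p g) :
    AffineModSq p fun w => f w * g w := by
  obtain ⟨hf0, a, ha, hfa⟩ := hf
  obtain ⟨hg0, b, hb, hgb⟩ := hg
  refine ⟨hf0.mul_left hg0, f 0 * b + g 0 * a, (hf0.mul_left hb).add (hg0.mul_left ha),
    fun w hw => ?_⟩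
  have h1 := hfa w hw
  have h2 := hgb w hw
  have hw0 := hw.mono (Nat.zero_le 1)
  have h3 : PDvd p 0 (g 0 + w * b) := hg0.add (hw0.mul_left hb)
  have h4 : PDvd p 0 (f w) := by
    have := ((h1.mono (Nat.zero_le 2)).add hf0).add (hw0.mul_left ha)
    convert this using 1
    ring
  convert ((h4.mul_left h2).add (h1.mul_right h3)).add
    ((hw.mul hw).mul_right (ha.mul_left hb)) using 1
  ring

theorem pow (hf : AffineModSq p f) (n : ℕ) : AffineModSq p fun w => f w ^ n := by
  induction n with
  | zero => simpa using const PDvd.one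
  | succ n ih => simpa [pow_succ] using ih.mul hf

theorem sum {ι : Type*} {s : Finset ι} {F : ι → ℚ → ℚ} (h : ∀ i ∈ s, AffineModSq p (F i)) :
    AffineModSq p fun w => ∑ i ∈ s, F i w := by
  classical
  induction s using Finset.induction_on with
  | empty => simpa using const PDvd.zero
  | insert i s hi ih =>
    simp only [Finset.sum_insert hi]
    exact (h i (by simp)).add (ih fun j hj => h j (by simp [hj]))

theorem prod {ι : Type*} {s : Finset ι} {F : ι → ℚ → ℚ} (h : ∀ i ∈ s, AffineModSq p (F i)) :
    AffineModSq p fun w => ∏ i ∈ s, F i w := by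
  classical
  induction s using Finset.induction_on with
  | empty => simpa using const PDvd.one
  | insert i s hi ih =>
    simp only [Finset.prod_insert hi]
    exact (h i (by simp)).mul (ih fun j hj => h j (by simp [hj]))

theorem div_add {n d : ℚ} (hn : PDvd p 0 n) (hd : padicNorm p d = 1) :
    AffineModSq p fun w => (n + w) / (d + w) := by
  have hdi := PDvd.of_norm_eq_one hd
  -- The slope is the derivative at `0`; the remainder is `w ^ 2 (n - d) / (d ^ 2 (d + w))`.
  refine ⟨by simpa using hn.div hd, (d - n) / d / d, ((hdi.sub hn).div hd).div hd,
    fun w hw => ?_⟩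
  have hd' := hw.norm_add_eq_one hd
  have h0 : d ≠ 0 := by rintro rfl; simp at hd
  have h0' : d + w ≠ 0 := by intro h; simp [h] at hd'
  convert ((((hw.mul hw).mul_right (hn.sub hdi)).div hd).div hd).div hd' using 1
  simp only [add_zero]
  field_simp
  ring

/-- An even function which is affine modulo `p ^ 2` is constant modulo `p ^ 2`. -/
theorem sub_zero_of_even (hp2 : p ≠ 2) (hf : AffineModSq p f) (he : ∀ w, f (-w) = f w) {w : ℚ}
    (hw : PDvd p 1 w) : PDvd p 2 (f w - f 0) := by
  obtain ⟨-, a, -, hfa⟩ := hf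
  have h1 := hfa w hw
  have h2 := hfa (-w) hw.neg
  rw [he] at h2
  have hu : padicNorm p 2 = 1 := by
    have := (padicNorm.nat_eq_one_iff (p := p) 2).2
      fun h => hp2 ((Nat.prime_dvd_prime_iff_eq hp.out Nat.prime_two).1 h)
    exact_mod_cast this
  refine PDvd.cancel_unit hu ?_
  convert h1.add h2 using 1
  ring

end AffineModSq

/-! ### Half a residue block modulo `p ^ 2` -/

section Residue

variable {p : ℕ} [hp : Fact p.Prime] {m : ℕ}

theorem padicNorm_natCast_eq_one {n : ℕ} (h0 : 0 < n) (h : n < p) : padicNorm p n = 1 :=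
  (padicNorm.nat_eq_one_iff n).2 (Nat.not_dvd_of_pos_of_lt h0 h)

theorem padicNorm_even_eq_one (hm : p = 2 * m + 1) {j : ℕ} (hj : j + 1 < p) :
    padicNorm p (2 * j + 2) = 1 := by
  have h : padicNorm p (2 * j + 2 : ℕ) = 1 := by
    rw [padicNorm.nat_eq_one_iff, show 2 * j + 2 = 2 * (j + 1) by ring, hp.out.dvd_mul]
    rintro (h | h)
    · have := (Nat.prime_dvd_prime_iff_eq hp.out Nat.prime_two).1 h
      omega
    · exact Nat.not_dvd_of_pos_of_lt (by omega) hj h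
  exact_mod_cast h

theorem padicNorm_odd_eq_one (hm : p = 2 * m + 1) {j : ℕ} (hj : j < m) :
    padicNorm p (2 * j + 1) = 1 := by
  exact_mod_cast padicNorm_natCast_eq_one (p := p) (n := 2 * j + 1) (by omega) (by omega)

theorem pDvd_odd_add (j : ℕ) {w : ℚ} (hw : PDvd p 0 w) : PDvd p 0 (2 * j + 1 + w) := by
  have h := PDvd.natCast (p := p) (2 * j + 1)
  push_cast at h
  exact h.add hw

theorem pDvd_halfRatio (hm : p = 2 * m + 1) {w : ℚ} (hw : PDvd p 1 w) {b : ℕ} (hb : b < p) :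
    PDvd p 0 (halfRatio w b) := by
  refine PDvd.prod fun j hj => ?_
  rw [Finset.mem_range] at hj
  exact (pDvd_odd_add j (hw.mono zero_le_one)).div
    (hw.norm_add_eq_one (padicNorm_even_eq_one hm (by omega)))

/-- The factor with `j = m` has numerator `2 m + 1 + w = p + w`. -/
theorem pDvd_halfRatio_of_lt (hm : p = 2 * m + 1) {w : ℚ} (hw : PDvd p 1 w) {e : ℕ}
    (he : PDvd p e (p + w)) {b : ℕ} (hmb : m < b) (hb : b < p) :
    PDvd p e (halfRatio w b) := by
  induction b, Nat.succ_le_of_lt hmb using Nat.le_induction with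
  | base =>
    rw [halfRatio_succ]
    refine (pDvd_halfRatio hm hw (by omega)).mul_left (PDvd.div ?_
      (hw.norm_add_eq_one (padicNorm_even_eq_one hm hb)))
    convert he using 2
    rw [hm]
    push_cast
    ring
  | succ b h ih =>
    rw [halfRatio_succ]
    exact (ih h (by omega)).mul_right ((pDvd_odd_add b (hw.mono zero_le_one)).div
      (hw.norm_add_eq_one (padicNorm_even_eq_one hm hb)))

theorem padicNorm_halfRatio_zero (hm : p = 2 * m + 1) {b : ℕ} (hb : b ≤ m) :
    padicNorm p (halfRatio 0 b) = 1 := by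
  induction b with
  | zero => simp
  | succ b ih =>
    rw [halfRatio_succ, padicNorm.mul, padicNorm.div, add_zero, add_zero,
      padicNorm_odd_eq_one hm (by omega), padicNorm_even_eq_one hm (by omega), ih (by omega)]
    simp

theorem affineModSq_halfRatio (hm : p = 2 * m + 1) {b : ℕ} (hb : b ≤ m) :
    AffineModSq p fun w => halfRatio w b := by
  refine AffineModSq.prod fun j hj => ?_
  rw [Finset.mem_range] at hj
  refine AffineModSq.div_add ?_ (padicNorm_even_eq_one hm (by omega))
  simpa using pDvd_odd_add (p := p) j PDvd.zero

theorem halfRatio_reflect {b : ℕ} (hb : b ≤ m) :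
    halfRatio 0 (m - b) = halfRatio 0 m * halfRatio (-(2 * m + 1)) b := by
  induction b with
  | zero => simp
  | succ b ih =>
    obtain ⟨c, rfl⟩ := Nat.exists_eq_add_of_le hb
    have ih := ih (by omega)
    rw [show b + 1 + c - b = c + 1 by omega, halfRatio_succ] at ih
    rw [show b + 1 + c - (b + 1) = c by omega, halfRatio_succ, ← mul_assoc, ← ih]
    push_cast
    have h1 : (2 * b + 1 + -(2 * (b + 1 + c) + 1) : ℚ) = -(2 * c + 2) := by ring
    have h2 : (2 * b + 2 + -(2 * (b + 1 + c) + 1) : ℚ) = -(2 * c + 1) := by ring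
    have h3 : (2 * c + 1 : ℚ) ≠ 0 := by positivity
    have h4 : (2 * c + 2 : ℚ) ≠ 0 := by positivity
    rw [h1, h2, add_zero, add_zero]
    field_simp

theorem sum_halfRatio_reflect (m n : ℕ) :
    ∑ b ∈ Finset.range (m + 1), halfRatio 0 b ^ n =
      halfRatio 0 m ^ n * ∑ b ∈ Finset.range (m + 1), halfRatio (-(2 * m + 1)) b ^ n := by
  rw [← Finset.sum_range_reflect, Finset.mul_sum]
  refine Finset.sum_congr rfl fun b hb => ?_
  rw [Finset.mem_range] at hb
  rw [show m + 1 - 1 - b = m - b by omega, halfRatio_reflect (by omega), mul_pow]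

theorem pDvd_dixon_value (hm : p = 2 * m + 1) (hp4 : p % 4 = 3) :
    PDvd p 2 ((2 * m + 1) * ∏ j ∈ Finset.range m, ((4 * j + 3) / (4 * j + 5) : ℚ)) := by
  have hpm : (2 * m + 1 : ℚ) = p := by rw [hm]; push_cast; rfl
  rw [hpm]
  refine PDvd.self.mul (f := 1) ?_
  have hu : ∀ j < m, padicNorm p (4 * j + 5) = 1 := by
    intro j hj
    have h : padicNorm p (4 * j + 5 : ℕ) = 1 := by
      rw [padicNorm.nat_eq_one_iff]
      rintro ⟨c, hc⟩
      -- Since `4 j + 5 < 2 p`, the only candidate multiple is `p` itself, excluded by `p ≡ 3`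
      -- modulo 4.
      have hc2 : c < 2 := by
        by_contra! h
        have := Nat.mul_le_mul_left p h
        omega
      interval_cases c <;> omega
    exact_mod_cast h
  -- The second factor `p` is the numerator `4 j + 3` at `j = (p - 3) / 4`.
  have hj : p / 4 ∈ Finset.range m := Finset.mem_range.2 (by omega)
  rw [← Finset.mul_prod_erase _ _ hj]
  refine PDvd.mul_right ?_ (PDvd.prod fun j hj => ?_)
  · refine PDvd.div ?_ (hu _ (Finset.mem_range.1 hj))
    have h : 4 * (p / 4) + 3 = p := by omega
    have h' : (4 * ((p / 4 : ℕ) : ℚ) + 3) = p := by exact_mod_cast h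
    rw [h']
    exact PDvd.self
  · refine PDvd.div ?_ (hu _ (Finset.mem_range.1 (Finset.mem_of_mem_erase hj)))
    exact_mod_cast PDvd.natCast (p := p) (4 * j + 3)

/-- The sum of cubes over the first half of a residue block vanishes modulo `p ^ 2`. -/
theorem pDvd_sum_halfRatio_cube (hm : p = 2 * m + 1) (hp4 : p % 4 = 3) {w : ℚ}
    (hw : PDvd p 1 w) : PDvd p 2 (∑ b ∈ Finset.range (m + 1), halfRatio w b ^ 3) := by
  have hpm : (2 * m + 1 : ℚ) = p := by rw [hm]; push_cast; rfl
  have hr : ∀ b ∈ Finset.range (m + 1), AffineModSq p fun w => halfRatio w b :=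
    fun b hb => affineModSq_halfRatio hm (by rw [Finset.mem_range] at hb; omega)
  have hr0 : ∀ b ∈ Finset.range (m + 1), PDvd p 0 (halfRatio 0 b) := fun b hb => (hr b hb).1
  have hD : AffineModSq p fun w => ∑ b ∈ Finset.range (m + 1), dixonTerm w b :=
    AffineModSq.sum fun b hb =>
      ((AffineModSq.const (hr0 b hb)).mul (hr b hb)).mul (hr b hb).comp_neg
  have h1 := hD.sub_zero_of_even (by omega)
    (fun w => Finset.sum_congr rfl fun b _ => by simp only [dixonTerm, neg_neg]; ring) PDvd.self
  have hT0 : PDvd p 2 (∑ b ∈ Finset.range (m + 1), halfRatio 0 b ^ 3) := by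
    have h2 : ∑ b ∈ Finset.range (m + 1), dixonTerm p b = _ := hpm ▸ sum_dixonTerm m
    have h3 := (pDvd_dixon_value hm hp4).sub h1
    rw [hpm] at h3
    rw [h2] at h3
    convert h3 using 1
    rw [sub_sub_cancel]
    refine Finset.sum_congr rfl fun b _ => ?_
    simp only [dixonTerm, neg_zero]
    ring
  have hTm : PDvd p 2 (∑ b ∈ Finset.range (m + 1), halfRatio (-p) b ^ 3) := by
    have h2 := hT0
    rw [sum_halfRatio_reflect, hpm] at h2
    refine PDvd.cancel_unit ?_ h2
    have hu := padicNorm_halfRatio_zero hm le_rfl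
    simp [pow_succ, padicNorm.mul, hu]
  have hT : AffineModSq p fun w => ∑ b ∈ Finset.range (m + 1), halfRatio w b ^ 3 :=
    AffineModSq.sum fun b hb => (hr b hb).pow 3
  obtain ⟨-, d, -, hd⟩ := hT
  -- Vanishing at both `0` and `-p` forces `p d` into `p ^ 2 ℤ_(p)`.
  have hd1 : PDvd p 1 d := by
    refine PDvd.cancel_self ?_
    convert ((hd _ PDvd.self.neg).sub hTm).add hT0 using 1
    ring
  convert ((hd w hw).add hT0).add (hw.mul hd1) using 1
  ring

end Residue

/-! ### Rising factorials and the comparison factor -/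

theorem halfRatio_zero_eq_centralBinom (k : ℕ) :
    halfRatio 0 k = (Nat.centralBinom k : ℚ) / 4 ^ k := by
  induction k with
  | zero => simp
  | succ k ih =>
    have h : ((k + 1 : ℕ) : ℚ) * (k + 1).centralBinom = 2 * (2 * k + 1) * k.centralBinom := by
      exact_mod_cast Nat.succ_mul_centralBinom_succ k
    push_cast at h
    have h1 : (k + 1 : ℚ) ≠ 0 := by positivity
    have h2 : ((k + 1).centralBinom : ℚ) = 2 * (2 * k + 1) * k.centralBinom / (k + 1) := by
      rw [eq_div_iff h1, ← h]
      ring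
    rw [halfRatio_succ, ih, h2, add_zero, add_zero, pow_succ]
    field_simp
    ring

theorem risingFactorial_succ (a : ℚ) (n : ℕ) :
    risingFactorial a (n + 1) = risingFactorial a n * (a + n) :=
  ascPochhammer_succ_eval n a

theorem risingFactorial_half_div_factorial (k : ℕ) :
    risingFactorial (1 / 2) k / k.factorial = halfRatio 0 k := by
  induction k with
  | zero => simp [risingFactorial]
  | succ k ih =>
    rw [halfRatio_succ, ← ih, risingFactorial_succ, Nat.factorial_succ]
    have h1 : (k + 1 : ℚ) ≠ 0 := by positivity
    have h2 : (k.factorial : ℚ) ≠ 0 := by positivity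
    push_cast
    rw [add_zero, add_zero]
    field_simp
    ring

theorem risingFactorial_div_eq_prod (N : ℕ) :
    risingFactorial (3 / 4) N / risingFactorial (5 / 4) N =
      ∏ j ∈ Finset.range N, ((4 * j + 3) / (4 * j + 5) : ℚ) := by
  induction N with
  | zero => simp [risingFactorial]
  | succ N ih =>
    rw [Finset.prod_range_succ, ← ih, risingFactorial_succ, risingFactorial_succ, mul_div_mul_comm]
    congr 1
    have h1 : (4 * N + 5 : ℚ) ≠ 0 := by positivity
    have h2 : (5 / 4 + N : ℚ) ≠ 0 := by positivity
    rw [div_eq_div_iff h2 h1]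
    ring

/-- The factor by which `j`-th factors of `dixonTerm w` and of `halfRatio 0 ^ 3` differ. -/
def dixonFactor (w : ℚ) (j : ℕ) : ℚ :=
  (1 - (w / (2 * j + 1)) ^ 2) / (1 - (w / (2 * j + 2)) ^ 2)

theorem dixonTerm_eq_mul_prod {w : ℚ} {k : ℕ} (h : ∀ j < k, (2 * j + 2 : ℚ) < w) :
    dixonTerm w k = halfRatio 0 k ^ 3 * ∏ j ∈ Finset.range k, dixonFactor w j := by
  induction k with
  | zero => simp [dixonTerm]
  | succ k ih =>
    rw [dixonTerm_succ, halfRatio_succ, Finset.prod_range_succ, ih fun j hj => h j (by omega),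
      dixonFactor]
    have hk := h k (by omega)
    have h1 : (2 * k + 1 : ℚ) ≠ 0 := by positivity
    have h2 : (2 * k + 2 : ℚ) ≠ 0 := by positivity
    have h3 : (2 * k + 2 - w : ℚ) ≠ 0 := by linarith
    have h4 : (2 * k + 2 + w : ℚ) ≠ 0 := by
      have : (0 : ℚ) ≤ k := by positivity
      linarith
    have h5 : 1 - (w / (2 * k + 2)) ^ 2 =
        (2 * k + 2 - w) * (2 * k + 2 + w) / (2 * k + 2) ^ 2 := by
      field_simp
      ring
    rw [h5, add_zero, add_zero]
    field_simp
    ring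

theorem sum_range_mul_blocks (g : ℕ → ℚ) (p A : ℕ) :
    ∑ k ∈ Finset.range (A * p), g k =
      ∑ a ∈ Finset.range A, ∑ b ∈ Finset.range p, g (a * p + b) := by
  induction A with
  | zero => simp
  | succ A ih => rw [Nat.succ_mul, Finset.sum_range_add, ih, Finset.sum_range_succ]

theorem half_sq_sub_one {p m : ℕ} (hm : p = 2 * m + 1) : (p ^ 2 - 1) / 2 = m * p + m := by
  have : p ^ 2 = 2 * (m * p + m) + 1 := by rw [hm]; ring
  omega

/-! ### Block-by-block comparison modulo `p ^ 4` -/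

section Residue

variable {p : ℕ} [hp : Fact p.Prime] {m : ℕ}

theorem pDvd_halfRatio_zero (hp2 : p ≠ 2) {e k : ℕ} (h : p ^ e ∣ k.centralBinom) :
    PDvd p e (halfRatio 0 k) := by
  rw [halfRatio_zero_eq_centralBinom]
  refine PDvd.div ?_ ?_
  · exact_mod_cast PDvd.of_dvd (p := p) (z := (k.centralBinom : ℤ)) (by exact_mod_cast h)
  · have := (padicNorm.nat_eq_one_iff (p := p) (4 ^ k)).2 fun h => hp2 <| by
      have h' : p ∣ 2 ^ 2 := hp.out.dvd_of_dvd_pow h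
      exact (Nat.prime_dvd_prime_iff_eq hp.out Nat.prime_two).1 (hp.out.dvd_of_dvd_pow h')
    exact_mod_cast this

/-- Lucas reduces this to `(2a choose a)`, where adding `a + a` in base `p` produces a carry. -/
theorem dvd_centralBinom_mul {a : ℕ} (h1 : p ≤ 2 * a) (h2 : a < p) :
    p ∣ (a * p).centralBinom := by
  have h := Choose.choose_modEq_choose_mod_mul_choose_div_nat (p := p) (n := 2 * (a * p))
    (k := a * p)
  have e : 2 * (a * p) = 2 * a * p := by ring
  rw [e, Nat.mul_mod_left, Nat.mul_mod_left, Nat.mul_div_cancel _ hp.out.pos,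
    Nat.mul_div_cancel _ hp.out.pos, Nat.choose_self, one_mul] at h
  rw [Nat.centralBinom, e, h.dvd_iff dvd_rfl, two_mul]
  exact hp.out.dvd_choose_add h2 h2 (by omega)

theorem PDvd.sum_blocks {g : ℕ → ℚ} {e A : ℕ} (hm : p = 2 * m + 1)
    (h1 : ∀ a < A, PDvd p e (∑ b ∈ Finset.range (m + 1), g (a * p + b)))
    (h2 : ∀ a < A, ∀ b, m < b → b < p → PDvd p e (g (a * p + b))) :
    PDvd p e (∑ k ∈ Finset.range (A * p), g k) := by
  rw [sum_range_mul_blocks]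
  refine PDvd.sum fun a ha => ?_
  rw [Finset.mem_range] at ha
  rw [show p = (m + 1) + m by omega, Finset.sum_range_add, ← show p = (m + 1) + m by omega]
  refine (h1 a ha).add (PDvd.sum fun b hb => h2 a ha _ (by omega) ?_)
  rw [Finset.mem_range] at hb
  omega

theorem pDvd_two_mul_cast (a : ℕ) : PDvd p 1 (2 * ((a * p : ℕ) : ℚ)) := by
  have h := (PDvd.natCast (p := p) (2 * a)).mul_left PDvd.self
  convert h using 1
  push_cast
  ring

theorem halfRatio_block (p a b : ℕ) :
    halfRatio 0 (a * p + b) = halfRatio 0 (a * p) * halfRatio (2 * ((a * p : ℕ) : ℚ)) b := by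
  rw [halfRatio_add, zero_add]

theorem pDvd_sum_halfRatio_block (hm : p = 2 * m + 1) (hp4 : p % 4 = 3) {e : ℕ} (a : ℕ)
    (h : PDvd p e (halfRatio 0 (a * p))) :
    PDvd p (3 * e + 2) (∑ b ∈ Finset.range (m + 1), halfRatio 0 (a * p + b) ^ 3) := by
  simp only [halfRatio_block, mul_pow, ← Finset.mul_sum]
  exact (h.pow 3).mul (pDvd_sum_halfRatio_cube hm hp4 (pDvd_two_mul_cast a))

theorem pDvd_halfRatio_block (hm : p = 2 * m + 1) {a b e : ℕ}
    (h : PDvd p e (halfRatio 0 (a * p))) (hmb : m < b) (hb : b < p) :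
    PDvd p (e + 1) (halfRatio 0 (a * p + b)) := by
  rw [halfRatio_block]
  exact h.mul (pDvd_halfRatio_of_lt hm (pDvd_two_mul_cast a)
    (PDvd.self.add (pDvd_two_mul_cast a)) hmb hb)

/-- Below `p ^ 2`, `n` contains at most one factor `p`. -/
theorem pDvd_sq_div_sq {n : ℕ} (h0 : 0 < n) (h : n < p ^ 2) :
    PDvd p 2 (((p : ℚ) ^ 2 / n) ^ 2) := by
  have hp0 : (p : ℚ) ≠ 0 := by exact_mod_cast hp.out.ne_zero
  have key : PDvd p 1 ((p : ℚ) ^ 2 / n) := by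
    by_cases hd : p ∣ n
    · obtain ⟨c, rfl⟩ := hd
      have hc : c < p := by
        rw [sq] at h
        exact lt_of_mul_lt_mul_left h (Nat.zero_le p)
      have hc0 : 0 < c := Nat.pos_of_mul_pos_left h0
      have := (PDvd.self (p := p)).div (padicNorm_natCast_eq_one hc0 hc)
      convert this using 1
      push_cast
      field_simp
    · exact ((PDvd.self.pow 2).mono (by norm_num)).div ((padicNorm.nat_eq_one_iff n).2 hd)
  exact key.pow 2

theorem PDvd.one_sub_div_one_sub {e : ℕ} (he : 0 < e) {x y : ℚ} (hx : PDvd p e x)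
    (hy : PDvd p e y) : PDvd p e ((1 - x) / (1 - y) - 1) := by
  have h1 : padicNorm p (1 - y) = 1 := by
    rw [sub_eq_add_neg]
    exact (hy.neg.mono (Nat.succ_le_of_lt he)).norm_add_eq_one padicNorm.one
  have h0 : 1 - y ≠ 0 := by intro h; simp [h] at h1
  have h2 : (1 - x) / (1 - y) - 1 = (y - x) / (1 - y) := by
    field_simp
    ring
  rw [h2]
  exact (hy.sub hx).div h1

theorem pDvd_dixonFactor {j : ℕ} (h : 2 * j + 2 < p ^ 2) :
    PDvd p 2 (dixonFactor ((p : ℚ) ^ 2) j - 1) := by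
  refine PDvd.one_sub_div_one_sub two_pos ?_ ?_
  · exact_mod_cast pDvd_sq_div_sq (p := p) (n := 2 * j + 1) (by omega) (by omega)
  · exact_mod_cast pDvd_sq_div_sq (p := p) (n := 2 * j + 2) (by omega) (by omega)

theorem pDvd_dixonFactor_block (hm : p = 2 * m + 1) (a : ℕ) {b : ℕ} (hb : b < m) :
    PDvd p 4 (dixonFactor ((p : ℚ) ^ 2) (a * p + b) - 1) := by
  have key : ∀ u : ℚ, padicNorm p u = 1 →
      PDvd p 4 (((p : ℚ) ^ 2 / (u + 2 * ((a * p : ℕ) : ℚ))) ^ 2) := fun u hu =>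
    ((PDvd.self.pow 2).div ((pDvd_two_mul_cast a).norm_add_eq_one hu)).pow 2
  have h1 := key _ (padicNorm_odd_eq_one hm hb)
  have h2 := key _ (padicNorm_even_eq_one hm (j := b) (by omega))
  convert PDvd.one_sub_div_one_sub (by norm_num) h1 h2 using 1
  rw [dixonFactor]
  push_cast
  congr 5 <;> ring

theorem pDvd_prod_dixonFactor {k : ℕ} (h : 2 * k < p ^ 2) :
    PDvd p 2 (∏ j ∈ Finset.range k, dixonFactor ((p : ℚ) ^ 2) j - 1) :=
  PDvd.prod_sub_one fun j hj => pDvd_dixonFactor (by rw [Finset.mem_range] at hj; omega)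

/-- The cube sum and Dixon's sum agree modulo `p ^ 4` over the first half of a residue block. -/
theorem pDvd_sum_sub_dixonTerm (hm : p = 2 * m + 1) (hp4 : p % 4 = 3) {a : ℕ} (ha : a ≤ m) :
    PDvd p 4 (∑ b ∈ Finset.range (m + 1),
      (halfRatio 0 (a * p + b) ^ 3 - dixonTerm ((p : ℚ) ^ 2) (a * p + b))) := by
  have hp2 : p ≠ 2 := by omega
  have hint : ∀ k, PDvd p 0 (halfRatio 0 k) := fun k => pDvd_halfRatio_zero hp2 (by simp)
  have hlt : ∀ b ≤ m, 2 * (a * p + b) < p ^ 2 := by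
    intro b hb
    have := Nat.mul_le_mul_right p ha
    nlinarith
  set E : ℚ := ∏ j ∈ Finset.range (a * p), dixonFactor ((p : ℚ) ^ 2) j with hE
  have hE1 : PDvd p 2 (E - 1) := pDvd_prod_dixonFactor (by simpa using hlt 0 (Nat.zero_le m))
  have hE0 : PDvd p 0 E := by
    convert (hE1.mono (Nat.zero_le 2)).add PDvd.one using 1
    ring
  -- With `F` the product of the factors inside the block, this expression is `-halfRatio ^ 3 * E *
  -- (F - 1)`; `E` does not depend on `b` and factors out of the sum.
  have hterm : ∀ b ∈ Finset.range (m + 1), PDvd p 4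
      (halfRatio 0 (a * p + b) ^ 3 - dixonTerm ((p : ℚ) ^ 2) (a * p + b) +
        halfRatio 0 (a * p + b) ^ 3 * (E - 1)) := by
    intro b hb
    rw [Finset.mem_range] at hb
    have hlt' := hlt b (by omega)
    rw [dixonTerm_eq_mul_prod, Finset.prod_range_add, ← hE]
    · have h := PDvd.prod_sub_one (p := p) (e := 4) (s := Finset.range b)
        (g := fun j => dixonFactor ((p : ℚ) ^ 2) (a * p + j)) fun j hj =>
          pDvd_dixonFactor_block hm a (by rw [Finset.mem_range] at hj; omega)
      convert ((((hint (a * p + b)).pow_integral 3).mul_left (hE0.mul_left h))).neg using 1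
      ring
    · intro j hj
      have : 2 * j + 2 < p ^ 2 := by omega
      exact_mod_cast this
  have h1 := PDvd.sum hterm
  rw [Finset.sum_add_distrib, ← Finset.sum_mul] at h1
  have h2 := (pDvd_sum_halfRatio_block hm hp4 a (hint (a * p))).mul hE1
  convert h1.sub h2 using 1
  ring

theorem pDvd_halfRatio_sub_dixonTerm (hm : p = 2 * m + 1) {a b : ℕ} (ha : a < m) (hmb : m < b)
    (hb : b < p) :
    PDvd p 4 (halfRatio 0 (a * p + b) ^ 3 - dixonTerm ((p : ℚ) ^ 2) (a * p + b)) := by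
  have hlt : 2 * (a * p + b) < p ^ 2 := by
    have := Nat.mul_le_mul_right p (Nat.succ_le_of_lt ha)
    nlinarith
  rw [dixonTerm_eq_mul_prod]
  · have h0 : PDvd p 0 (halfRatio 0 (a * p)) := pDvd_halfRatio_zero (by omega) (by simp)
    have h1 := ((pDvd_halfRatio_block hm h0 hmb hb).pow 3).mul (pDvd_prod_dixonFactor hlt)
    convert (h1.mono (show 4 ≤ _ by norm_num)).neg using 1
    ring
  · intro j hj
    have : 2 * j + 2 < p ^ 2 := by omega
    exact_mod_cast this

theorem pDvd_truncated_sum (hm : p = 2 * m + 1) (hp4 : p % 4 = 3) :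
    PDvd p 4 (∑ k ∈ Finset.range (m * p + (m + 1)), halfRatio 0 k ^ 3 -
      (p : ℚ) ^ 2 * ∏ j ∈ Finset.range (m * p + m), ((4 * j + 3) / (4 * j + 5) : ℚ)) := by
  have h := sum_dixonTerm (m * p + m)
  have hP : 2 * ((m * p + m : ℕ) : ℚ) + 1 = (p : ℚ) ^ 2 := by
    rw [hm]
    push_cast
    ring
  rw [hP] at h
  rw [← h, ← add_assoc, ← Finset.sum_sub_distrib, add_assoc, Finset.sum_range_add]
  refine PDvd.add ?_ (pDvd_sum_sub_dixonTerm hm hp4 le_rfl)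
  exact PDvd.sum_blocks (g := fun k => halfRatio 0 k ^ 3 - dixonTerm ((p : ℚ) ^ 2) k) hm
    (fun a ha => pDvd_sum_sub_dixonTerm hm hp4 ha.le)
    fun a ha b hmb hb => pDvd_halfRatio_sub_dixonTerm hm ha hmb hb

theorem pDvd_tail_sum (hm : p = 2 * m + 1) (hp4 : p % 4 = 3) :
    PDvd p 4 (∑ k ∈ Finset.range (p * p), halfRatio 0 k ^ 3 -
      ∑ k ∈ Finset.range (m * p + (m + 1)), halfRatio 0 k ^ 3) := by
  have hp2 : p ≠ 2 := by omega
  -- The tail is the second half of block `m`, followed by the `m` full blocks `m + 1, …, 2 m`.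
  have hpp : p * p = (m * p + (m + 1)) + m + m * p := by
    conv_lhs => rw [hm]
    rw [hm]
    ring
  have hpos : ∀ a < m, PDvd p 1 (halfRatio 0 ((a + (m + 1)) * p)) := fun a ha =>
    pDvd_halfRatio_zero hp2 (by simpa using dvd_centralBinom_mul (by omega) (by omega))
  have hidx : ∀ a b, m * p + (m + 1) + m + (a * p + b) = (a + (m + 1)) * p + b := by
    intro a b
    rw [hm]
    ring
  rw [hpp, Finset.sum_range_add, Finset.sum_range_add _ (m * p + (m + 1)) m, add_assoc,
    add_sub_cancel_left]
  refine PDvd.add (PDvd.sum fun c hc => ?_) (PDvd.sum_blocks hm (fun a ha => ?_)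
    fun a ha b hmb hb => ?_)
  · rw [Finset.mem_range] at hc
    rw [add_assoc, halfRatio_block]
    have h0 : PDvd p 0 (halfRatio 0 (m * p)) := pDvd_halfRatio_zero hp2 (by simp)
    -- In block `m` the vanishing numerator is `p + 2 m p = p ^ 2`.
    have h1 : PDvd p 2 ((p : ℚ) + 2 * ((m * p : ℕ) : ℚ)) := by
      convert (PDvd.self (p := p)).pow 2 using 1
      rw [hm]
      push_cast
      ring
    exact ((h0.mul_left (pDvd_halfRatio_of_lt hm (pDvd_two_mul_cast m) h1 (by omega)
      (by omega))).pow 3).mono (by norm_num)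
  · simp only [hidx]
    exact (pDvd_sum_halfRatio_block hm hp4 _ (hpos a ha)).mono (by norm_num)
  · rw [hidx]
    exact ((pDvd_halfRatio_block hm (hpos a ha) hmb hb).pow 3).mono (by norm_num)

end Residue

theorem mainTheorem3 (p : ℕ) (hp : p.Prime) (hp4 : p % 4 = 3) :
    RatModEq (p ^ 4)
      (∑ k ∈ Finset.Icc 0 ((p ^ 2 - 1) / 2),
        risingFactorial (1 / 2) k ^ 3 / (k.factorial : ℚ) ^ 3)
      ((p : ℚ) ^ 2 * (risingFactorial (3 / 4) ((p ^ 2 - 1) / 2) /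
        risingFactorial (5 / 4) ((p ^ 2 - 1) / 2))) ∧
    RatModEq (p ^ 4)
      (∑ k ∈ Finset.Icc 0 (p ^ 2 - 1),
        risingFactorial (1 / 2) k ^ 3 / (k.factorial : ℚ) ^ 3)
      ((p : ℚ) ^ 2 * (risingFactorial (3 / 4) ((p ^ 2 - 1) / 2) /
        risingFactorial (5 / 4) ((p ^ 2 - 1) / 2))) := by
  have : Fact p.Prime := ⟨hp⟩
  obtain ⟨m, hm⟩ : ∃ m, p = 2 * m + 1 := ⟨p / 2, by omega⟩
  have hIcc : ∀ n, Finset.Icc 0 n = Finset.range (n + 1) := fun n => by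
    ext k
    simp
  have hpp : p ^ 2 - 1 + 1 = p * p := by
    have := Nat.mul_pos hp.pos hp.pos
    rw [sq]
    omega
  simp only [hIcc, half_sq_sub_one hm, hpp, ← div_pow, risingFactorial_half_div_factorial,
    risingFactorial_div_eq_prod]
  have h1 := pDvd_truncated_sum hm hp4
  refine ⟨PDvd.ratModEq h1, PDvd.ratModEq ?_⟩
  convert (pDvd_tail_sum hm hp4).add h1 using 1
  ring
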